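/- Let $X\subset\mathbb R^{n_x}$ and $A\subset\mathbb R^{n_a}$ be compact, $A\neq\emptyset$, let $Q(\cdot\mid x,a)$ be a weak Feller transition probability kernel from $X\times A$ to $X$ (that is, $(Q^*V)(x,a):=\int_X V(y)\,Q(dy\mid x,a)$ is continuous on $X\times A$ for every $V\in C(X)$), let $\nu_0$ be a probability measure on $X$, $\alpha\in(0,1)$, and let $\varphi:X\times A\to\mathbb R^{n_\ell}$ be continuous. For a Markov policy $\pi=(\pi_t)_{t\ge0}$ (a sequence of probability kernels from $X$ to $A$) and a cost $\ell$ put $J_\ell(\pi)=\mathbb E\big[\sum_{t\ge0}\alpha^t\ell(x_t,a_t)\big]$, where $x_0\sim\nu_0$, $a_t\sim\pi_t(\cdot\mid x_t)$, $x_{t+1}\sim Q(\cdot\mid x_t,a_t)$. A stationary Markov policy is optimal for $\ell$ if it minimizes $J_\ell$ over all Markov policies. For $\theta\in\mathbb R^{n_\ell}$ let $V_\theta\in C(X)$ be the limit of the value iteration $V_0=0$, $V_{t+1}(x)=\inf_{a\in A}(\theta^\top\varphi+\alpha Q^*V_t)(x,a)$, and let $$I(\theta)=\int_{X\times A}\big(\theta^\top\varphi(x,a)+\alpha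 (Q^*V_\theta)(x,a)-V_\theta(x)\big)\,dx\,da .$$ Let the stationary Markov policy $\bar\pi$ (the expert policy) be optimal for the true cost $\bar\theta^\top\varphi$, and suppose that $I(\bar\theta)>0$ (regularity condition). Let $\mu_t$ be the law of $(x_t,a_t)$ under $\bar\pi$, let $\mu_\Sigma=\sum_{t\ge0}\alpha^t\mu_t$, let $N\ge1$ and $\mu^N=\frac{1-\alpha}{1-\alpha^N}\sum_{t=0}^{N-1}\alpha^t\mu_t$, and suppose that the $X$-marginal of $\mu_\Sigma$ is absolutely continuous with respect to the $X$-marginal of $\mu^N$ (persistent excitation). Consider, for real $\beta_V,\beta_\ell$, the linear program $$\min_{\psi,\theta,V}\ \int\psi\,d\mu^N\quad\text{s.t.}\quad \psi=\theta^\top\varphi+\alpha Q^*V-V,\quad \int_{X\times A}\psi\,dx\,da\ge1,\quad \psi\in C(X\times A),\ \psi\ge0,\quad V\in C(X),\quad \|V\|_\infty\le\beta_V,\ \|\theta\|_1\le\beta_\ell ,$$ and call $(\beta_V,\beta_\ell)$ large enough for a parameter $\theta$ with $I(\theta)>0$ if $\|V_\theta\|_\infty/I(\theta)\le\beta_V$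 and $\|\theta\|_1/I(\theta)\le\beta_\ell$. Suppose that $(\beta_V,\beta_\ell)$ is large enough for $\bar\theta$. Then: 1. The program attains its minimum, and the optimal value is $0$. 2. Let $\theta\in\mathbb R^{n_\ell}$. If there are $V$ and $\psi$ such that $(\psi,\theta,V)$ solves the program, then $\bar\pi$ is optimal for the cost $\theta^\top\varphi$. 3. Let $\theta\in\mathbb R^{n_\ell}$ satisfy $I(\theta)\ge1$, $\|V_\theta\|_\infty\le\beta_V$ and $\|\theta\|_1\le\beta_\ell$. Then $\bar\pi$ is optimal for $\theta^\top\varphi$ if and only if there are $V$ and $\psi$ such that $(\psi,\theta,V)$ solves the program. 4. Let $\theta\in\mathbb R^{n_\ell}$ satisfy $I(\theta)>0$, and let $(\beta_V,\beta_\ell)$ be large enough for $\theta$. Then $\bar\pi$ is optimal for $\theta^\top\varphi$ if and only if there are $c>0$, $V$ and $\psi$ such that $(\psi,c\theta,V)$ solves the program. -/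

import Mathlib

open MeasureTheory ProbabilityTheory Filter

noncomputable section

namespace IOC

/-! ### The controlled Markov chain and the discounted cost -/

section Chain

/-- The transition kernel is weak Feller: its adjoint maps `C(𝒳)` into `C(𝒳 × 𝒜)`
(the state space will be compact, so that continuous functions are bounded). -/
def WeakFeller {𝒳 𝒜 : Type*} [TopologicalSpace 𝒳] [MeasurableSpace 𝒳]
    [TopologicalSpace 𝒜] [MeasurableSpace 𝒜] (Q : Kernel (𝒳 × 𝒜) 𝒳) : Prop :=
  ∀ V : C(𝒳, ℝ), Continuous fun z : 𝒳 × 𝒜 => ∫ y, V y ∂(Q z)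

variable {𝒳 𝒜 : Type*} [MeasurableSpace 𝒳] [MeasurableSpace 𝒜]

/-- The law of `(x_{n+1}, a_{n+1})` given the history `(x_0, a_0), …, (x_n, a_n)`:
`x_{n+1} ∼ Q(· | x_n, a_n)` and then `a_{n+1} ∼ π_{n+1}(· | x_{n+1})`. -/
def stepKernel (Q : Kernel (𝒳 × 𝒜) 𝒳) (π : ℕ → Kernel 𝒳 𝒜) (n : ℕ) :
    Kernel ((i : Finset.Iic n) → 𝒳 × 𝒜) (𝒳 × 𝒜) :=
  (Q.compProd (Kernel.prodMkLeft (𝒳 × 𝒜) (π (n + 1)))).comap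
    (fun h => h ⟨n, Finset.mem_Iic.2 le_rfl⟩) (measurable_pi_apply _)

instance (Q : Kernel (𝒳 × 𝒜) 𝒳) [IsMarkovKernel Q] (π : ℕ → Kernel 𝒳 𝒜)
    [∀ t, IsMarkovKernel (π t)] (n : ℕ) : IsMarkovKernel (stepKernel Q π n) := by
  unfold stepKernel; infer_instance

/-- The law of the state-action trajectory `(x_t, a_t)_{t ≥ 0}` under the Markov policy
`(π_t)_{t ≥ 0}`, with `x_0 ∼ ν₀`. -/
def trajLaw (Q : Kernel (𝒳 × 𝒜) 𝒳) [IsMarkovKernel Q] (ν₀ : Measure 𝒳)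
    (π : ℕ → Kernel 𝒳 𝒜) [∀ t, IsMarkovKernel (π t)] : Measure (ℕ → 𝒳 × 𝒜) :=
  Kernel.trajMeasure (X := fun _ => 𝒳 × 𝒜) (ν₀.compProd (π 0)) (stepKernel Q π)

/-- The expected discounted cost `E [∑_t α^t ℓ(x_t, a_t)]` of a Markov policy. -/
def discountedCost (Q : Kernel (𝒳 × 𝒜) 𝒳) [IsMarkovKernel Q] (ν₀ : Measure 𝒳) (α : ℝ)
    (ℓ : 𝒳 × 𝒜 → ℝ) (π : ℕ → Kernel 𝒳 𝒜) [∀ t, IsMarkovKernel (π t)] : ℝ :=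
  ∫ ω, ∑' t, α ^ t * ℓ (ω t) ∂(trajLaw Q ν₀ π)

/-- The stationary Markov policy `πbar` minimizes the expected discounted cost among all
(possibly nonstationary) Markov policies. -/
def IsOptimal (Q : Kernel (𝒳 × 𝒜) 𝒳) [IsMarkovKernel Q] (ν₀ : Measure 𝒳) (α : ℝ)
    (ℓ : 𝒳 × 𝒜 → ℝ) (πbar : Kernel 𝒳 𝒜) [IsMarkovKernel πbar] : Prop :=
  ∀ (π : ℕ → Kernel 𝒳 𝒜) [∀ t, IsMarkovKernel (π t)],
    discountedCost Q ν₀ α ℓ (fun _ => πbar) ≤ discountedCost Q ν₀ α ℓ π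

/-- The occupation measure `μ_t`: the law of `(x_t, a_t)` under the stationary policy. -/
def occ (Q : Kernel (𝒳 × 𝒜) 𝒳) [IsMarkovKernel Q] (ν₀ : Measure 𝒳)
    (πbar : Kernel 𝒳 𝒜) [IsMarkovKernel πbar] (t : ℕ) : Measure (𝒳 × 𝒜) :=
  (trajLaw Q ν₀ fun _ => πbar).map fun ω => ω t

/-- `μ_Σ = ∑_{t ≥ 0} α^t μ_t`. -/
def occSum (Q : Kernel (𝒳 × 𝒜) 𝒳) [IsMarkovKernel Q] (ν₀ : Measure 𝒳) (α : ℝ)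
    (πbar : Kernel 𝒳 𝒜) [IsMarkovKernel πbar] : Measure (𝒳 × 𝒜) :=
  Measure.sum fun t => ENNReal.ofReal (α ^ t) • occ Q ν₀ πbar t

/-- `μ^N = γ ∑_{t < N} α^t μ_t` with `γ = (1 - α) / (1 - α^N)`. -/
def occN (Q : Kernel (𝒳 × 𝒜) 𝒳) [IsMarkovKernel Q] (ν₀ : Measure 𝒳) (α : ℝ)
    (πbar : Kernel 𝒳 𝒜) [IsMarkovKernel πbar] (N : ℕ) : Measure (𝒳 × 𝒜) :=
  ENNReal.ofReal ((1 - α) / (1 - α ^ N)) •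
    ∑ t ∈ Finset.range N, ENNReal.ofReal (α ^ t) • occ Q ν₀ πbar t

/-- Persistent excitation: `N ≥ 1` and the state marginal of `μ_Σ` is absolutely continuous
with respect to the state marginal of `μ^N`. -/
def PersistentExcitation (Q : Kernel (𝒳 × 𝒜) 𝒳) [IsMarkovKernel Q] (ν₀ : Measure 𝒳) (α : ℝ)
    (πbar : Kernel 𝒳 𝒜) [IsMarkovKernel πbar] (N : ℕ) : Prop :=
  1 ≤ N ∧ (occSum Q ν₀ α πbar).fst ≪ (occN Q ν₀ α πbar N).fst

/-! ### Value iteration -/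

/-- The value iteration operator `T(V)(x) = inf_a (ℓ(x, a) + α ∫ V dQ(· | x, a))`. -/
def bellman (Q : Kernel (𝒳 × 𝒜) 𝒳) (α : ℝ) (ℓ : 𝒳 × 𝒜 → ℝ) (V : 𝒳 → ℝ) : 𝒳 → ℝ :=
  fun x => ⨅ a : 𝒜, (ℓ (x, a) + α * ∫ y, V y ∂(Q (x, a)))

/-- The value function of the cost `ℓ`: the limit of the value iteration started at `0`. -/
def valueFn (Q : Kernel (𝒳 × 𝒜) 𝒳) (α : ℝ) (ℓ : 𝒳 × 𝒜 → ℝ) : 𝒳 → ℝ :=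
  fun x => limUnder atTop fun t : ℕ => ((bellman Q α ℓ)^[t] fun _ => 0) x

/-- The function `ℓ(x, a) + α ∫ V dQ(· | x, a) - V(x)`. -/
def slack (Q : Kernel (𝒳 × 𝒜) 𝒳) (α : ℝ) (ℓ : 𝒳 × 𝒜 → ℝ) (V : 𝒳 → ℝ) : 𝒳 × 𝒜 → ℝ :=
  fun z => ℓ z + α * ∫ y, V y ∂(Q z) - V z.1

/-- The cost `θᵀ φ`. -/
def cost {n : ℕ} (φ : 𝒳 × 𝒜 → Fin n → ℝ) (θ : Fin n → ℝ) : 𝒳 × 𝒜 → ℝ :=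
  fun z => ∑ i, θ i * φ z i

/-- The integral of `θᵀφ + α Q^* V_θ - V_θ` against the reference measure `lam`,
where `V_θ` is the value function of the cost `θᵀφ`. -/
def gap {n : ℕ} (lam : Measure (𝒳 × 𝒜)) (Q : Kernel (𝒳 × 𝒜) 𝒳) (α : ℝ)
    (φ : 𝒳 × 𝒜 → Fin n → ℝ) (θ : Fin n → ℝ) : ℝ :=
  ∫ z, slack Q α (cost φ θ) (valueFn Q α (cost φ θ)) z ∂lam

/-- The norm bounds `βV`, `βℓ` are not smaller than the norms of the pair `(θ, V_θ)` after the
rescaling that makes its `gap` equal to one. -/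
structure BoundsLargeEnough {n : ℕ} (lam : Measure (𝒳 × 𝒜)) (Q : Kernel (𝒳 × 𝒜) 𝒳) (α : ℝ)
    (φ : 𝒳 × 𝒜 → Fin n → ℝ) (βV βℓ : ℝ) (θ : Fin n → ℝ) : Prop where
  value_le : ∀ x, |valueFn Q α (cost φ θ) x| / gap lam Q α φ θ ≤ βV
  param_le : (∑ i, |θ i|) / gap lam Q α φ θ ≤ βℓ

end Chain

/-! ### The linear program -/

section Program

variable {𝒳 𝒜 : Type*} [TopologicalSpace 𝒳] [MeasurableSpace 𝒳]
  [TopologicalSpace 𝒜] [MeasurableSpace 𝒜] {n : ℕ}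

/-- The constraints of the program; `lam` is the reference measure on `𝒳 × 𝒜`. -/
structure Feasible (lam : Measure (𝒳 × 𝒜)) (Q : Kernel (𝒳 × 𝒜) 𝒳) (α : ℝ)
    (φ : 𝒳 × 𝒜 → Fin n → ℝ) (βV βℓ : ℝ)
    (ψ : C(𝒳 × 𝒜, ℝ)) (θ : Fin n → ℝ) (V : C(𝒳, ℝ)) : Prop where
  psi_eq : ∀ z, ψ z = slack Q α (cost φ θ) V z
  one_le_integral : 1 ≤ ∫ z, ψ z ∂lam
  psi_nonneg : ∀ z, 0 ≤ ψ z
  value_bound : ∀ x, |V x| ≤ βV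
  param_bound : ∑ i, |θ i| ≤ βℓ

/-- `(ψ, θ, V)` solves the program: it is feasible and minimizes `∫ ψ dμ`. -/
def Solves (lam μ : Measure (𝒳 × 𝒜)) (Q : Kernel (𝒳 × 𝒜) 𝒳) (α : ℝ)
    (φ : 𝒳 × 𝒜 → Fin n → ℝ) (βV βℓ : ℝ)
    (ψ : C(𝒳 × 𝒜, ℝ)) (θ : Fin n → ℝ) (V : C(𝒳, ℝ)) : Prop :=
  Feasible lam Q α φ βV βℓ ψ θ V ∧
    ∀ (ψ' : C(𝒳 × 𝒜, ℝ)) (θ' : Fin n → ℝ) (V' : C(𝒳, ℝ)),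
      Feasible lam Q α φ βV βℓ ψ' θ' V' → ∫ z, ψ z ∂μ ≤ ∫ z, ψ' z ∂μ

/-- The set of objective values of the feasible points. -/
def objectiveValues (lam μ : Measure (𝒳 × 𝒜)) (Q : Kernel (𝒳 × 𝒜) 𝒳) (α : ℝ)
    (φ : 𝒳 × 𝒜 → Fin n → ℝ) (βV βℓ : ℝ) : Set ℝ :=
  {r | ∃ (ψ : C(𝒳 × 𝒜, ℝ)) (θ : Fin n → ℝ) (V : C(𝒳, ℝ)),
    Feasible lam Q α φ βV βℓ ψ θ V ∧ r = ∫ z, ψ z ∂μ}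

end Program

/-- Lebesgue measure `dx da` on `X × A` for subsets `X`, `A` of Euclidean spaces. -/
def lebesgueOn {nx na : ℕ} (X : Set (EuclideanSpace ℝ (Fin nx)))
    (A : Set (EuclideanSpace ℝ (Fin na))) : Measure (X × A) :=
  (Measure.comap Subtype.val volume).prod (Measure.comap Subtype.val volume)

end IOC

end

/-!
Write `slack V = ℓ + α Q^* V - V`. For every continuous `V` and every Markov policy, the terms in `V`
telescope along the trajectory, so that the discounted cost equals `∫ V dν₀` plus the discounted sum
of the integrals of `slack V` against the laws of `(x_t, a_t)` (`hasSum_slack`). Optimality of the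
expert is therefore complementary slackness:

* if `slack V ≥ 0` and `slack V` vanishes almost surely along the expert, then the expert attains
  the lower bound `∫ V dν₀` of all costs (`isOptimal_of_slack_ae_eq_zero`);
* conversely, the value function is continuous and solves the Bellman equation, the Bellman operator
  being a contraction of `C(X)` (`exists_valueFn`). Its slack is nonnegative and has infimum zero
  over the actions, so that measurable `ε`-minimizers, chosen from a dense sequence of actions, give
  policies whose costs approach `∫ V dν₀` (`exists_discountedCost_le`). Along an optimal expert the
  slack of the value function must vanish (`slack_ae_eq_zero_of_isOptimal`).

The objective of the program is the integral of a nonnegative slack over the first `N` steps of the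
expert. The value function of the true cost, scaled to gap one, is feasible with objective zero, so
the solutions are the feasible points with objective zero. For such a point the slack vanishes almost
surely during the first `N` steps. All occupation measures of the expert disintegrate along its
stationary policy, so that persistent excitation, a condition on state marginals, lets the slack
vanish at all times (`ae_occ_of_ae_occN`).
-/

noncomputable section

namespace IOC

set_option linter.unusedSectionVars false

/-! ### Laws of the state-action pairs -/

section Marginals

variable {𝒳 𝒜 : Type*} [MeasurableSpace 𝒳] [MeasurableSpace 𝒜]

/-- The law of `(x_t, a_t)` under the Markov policy `π`. For a constant sequence `π` it is, by
definition, the occupation measure `occ`. -/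
def marginal (Q : Kernel (𝒳 × 𝒜) 𝒳) [IsMarkovKernel Q] (ν₀ : Measure 𝒳)
    (π : ℕ → Kernel 𝒳 𝒜) [∀ t, IsMarkovKernel (π t)] (t : ℕ) : Measure (𝒳 × 𝒜) :=
  (trajLaw Q ν₀ π).map fun ω => ω t

variable (Q : Kernel (𝒳 × 𝒜) 𝒳) [IsMarkovKernel Q] (ν₀ : Measure 𝒳) [IsProbabilityMeasure ν₀]
  (π : ℕ → Kernel 𝒳 𝒜) [∀ t, IsMarkovKernel (π t)]

instance : IsProbabilityMeasure (trajLaw Q ν₀ π) := by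
  unfold trajLaw; infer_instance

instance (t : ℕ) : IsProbabilityMeasure (marginal Q ν₀ π t) :=
  Measure.isProbabilityMeasure_map (measurable_pi_apply t).aemeasurable

lemma marginal_zero : marginal Q ν₀ π 0 = ν₀ ⊗ₘ π 0 := by
  have h : (trajLaw Q ν₀ π).map (Preorder.frestrictLe 0)
      = (ν₀ ⊗ₘ π 0).map (MeasurableEquiv.piUnique
          (fun _ : Finset.Iic (0 : ℕ) => 𝒳 × 𝒜)).symm := by
    unfold trajLaw Kernel.trajMeasure
    rw [Measure.map_comp _ _ (by fun_prop), Kernel.traj_map_frestrictLe, Kernel.partialTraj_self,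
      Measure.id_comp]
  have h2 : marginal Q ν₀ π 0 = ((trajLaw Q ν₀ π).map (Preorder.frestrictLe 0)).map
      (MeasurableEquiv.piUnique (fun _ : Finset.Iic (0 : ℕ) => 𝒳 × 𝒜)) := by
    rw [Measure.map_map (by fun_prop) (by fun_prop)]
    rfl
  rw [h2, h, Measure.map_map (by fun_prop) (by fun_prop), MeasurableEquiv.self_comp_symm,
    Measure.map_id]

/-- The laws of `(x_t, a_t)` satisfy the recursion of a Markov chain, since the step kernel depends
on the last entry of the history only. -/
lemma marginal_succ (t : ℕ) :
    marginal Q ν₀ π (t + 1) = (Q ∘ₘ marginal Q ν₀ π t) ⊗ₘ π (t + 1) := by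
  have h := Kernel.map_frestrictLe_trajMeasure_compProd_eq_map_trajMeasure
    (X := fun _ => 𝒳 × 𝒜) (μ₀ := ν₀ ⊗ₘ π 0) (κ := stepKernel Q π) (a := t)
  change (trajLaw Q ν₀ π).map (Preorder.frestrictLe t) ⊗ₘ stepKernel Q π t
    = (trajLaw Q ν₀ π).map _ at h
  have h1 : marginal Q ν₀ π (t + 1)
      = stepKernel Q π t ∘ₘ (trajLaw Q ν₀ π).map (Preorder.frestrictLe t) := by
    rw [← Measure.snd_compProd, h, Measure.snd, Measure.map_map (by fun_prop) (by fun_prop)]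
    rfl
  have h2 : marginal Q ν₀ π t = ((trajLaw Q ν₀ π).map (Preorder.frestrictLe t)).map
      (fun h => h ⟨t, Finset.mem_Iic.2 le_rfl⟩) := by
    rw [Measure.map_map (by fun_prop) (by fun_prop)]
    rfl
  ext s hs
  rw [h1, Measure.bind_apply hs (Kernel.aemeasurable _), Measure.compProd_apply hs,
    Measure.lintegral_bind (Kernel.aemeasurable _)
      (Kernel.measurable_kernel_prodMk_left hs).aemeasurable, h2,
    lintegral_map (Measurable.lintegral_kernel (Kernel.measurable_kernel_prodMk_left hs))
      (measurable_pi_apply _)]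
  refine lintegral_congr fun ω => ?_
  rw [stepKernel, Kernel.comap_apply, Kernel.compProd_apply hs]
  rfl

lemma fst_marginal_zero : (marginal Q ν₀ π 0).fst = ν₀ := by
  rw [marginal_zero, Measure.fst_compProd]

lemma fst_marginal_succ (t : ℕ) :
    (marginal Q ν₀ π (t + 1)).fst = Q ∘ₘ marginal Q ν₀ π t := by
  rw [marginal_succ, Measure.fst_compProd]

/-- Under a Markov policy, `a_t` is drawn from `π_t(· | x_t)`. -/
lemma fst_marginal_compProd (t : ℕ) :
    (marginal Q ν₀ π t).fst ⊗ₘ π t = marginal Q ν₀ π t := by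
  cases t with
  | zero => rw [fst_marginal_zero, marginal_zero]
  | succ t => rw [fst_marginal_succ, marginal_succ]

/-- The expected discounted cost is a series of integrals against the marginal laws. -/
lemma hasSum_discountedCost {α : ℝ} (hα₀ : 0 ≤ α) (hα₁ : α < 1) {ℓ : 𝒳 × 𝒜 → ℝ}
    (hℓ : Measurable ℓ) {C : ℝ} (hC : ∀ z, |ℓ z| ≤ C) :
    HasSum (fun t => α ^ t * ∫ z, ℓ z ∂(marginal Q ν₀ π t)) (discountedCost Q ν₀ α ℓ π) := by
  have hb : ∀ (t : ℕ) (ω : ℕ → 𝒳 × 𝒜), ‖α ^ t * ℓ (ω t)‖ ≤ α ^ t * C := fun t ω => by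
    rw [norm_mul, Real.norm_of_nonneg (pow_nonneg hα₀ t)]
    exact mul_le_mul_of_nonneg_left (hC _) (pow_nonneg hα₀ t)
  have hm : ∀ t : ℕ, Measurable fun ω : ℕ → 𝒳 × 𝒜 => α ^ t * ℓ (ω t) := fun t => by fun_prop
  have hint : ∀ t : ℕ, Integrable (fun ω : ℕ → 𝒳 × 𝒜 => α ^ t * ℓ (ω t)) (trajLaw Q ν₀ π) :=
    fun t => Integrable.of_bound (hm t).aestronglyMeasurable _ (ae_of_all _ (hb t))
  have hs : Summable fun t : ℕ => ∫ ω, ‖α ^ t * ℓ (ω t)‖ ∂(trajLaw Q ν₀ π) := by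
    refine Summable.of_nonneg_of_le (fun t => integral_nonneg fun _ => norm_nonneg _) (fun t => ?_)
      ((summable_geometric_of_lt_one hα₀ hα₁).mul_right C)
    calc _ ≤ ∫ _, α ^ t * C ∂(trajLaw Q ν₀ π) :=
          integral_mono (hint t).norm (integrable_const _) (hb t)
      _ = α ^ t * C := by simp
  convert! hasSum_integral_of_summable_integral_norm hint hs using 2 with t
  rw [marginal, integral_map (measurable_pi_apply t).aemeasurable hℓ.aestronglyMeasurable,
    integral_const_mul]

end Marginals

/-! ### Continuous functions on compact spaces -/

section Compact

lemma integrable_continuousMap {Z : Type*} [TopologicalSpace Z] [CompactSpace Z]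
    [MeasurableSpace Z] [OpensMeasurableSpace Z] (μ : Measure Z) [IsFiniteMeasure μ]
    (f : C(Z, ℝ)) : Integrable f μ :=
  Integrable.of_bound f.continuous.measurable.aestronglyMeasurable ‖f‖
    (ae_of_all _ f.norm_coe_le_norm)

lemma abs_integral_continuousMap_le {Z : Type*} [TopologicalSpace Z] [CompactSpace Z]
    [MeasurableSpace Z] (μ : Measure Z) [IsProbabilityMeasure μ]
    (f : C(Z, ℝ)) : |∫ z, f z ∂μ| ≤ ‖f‖ := by
  simpa using norm_integral_le_of_norm_le_const (μ := μ) (ae_of_all _ f.norm_coe_le_norm)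

variable {𝒳 𝒜 : Type*} [TopologicalSpace 𝒳] [CompactSpace 𝒳] [SecondCountableTopology 𝒳]
  [MeasurableSpace 𝒳] [BorelSpace 𝒳]
  [TopologicalSpace 𝒜] [CompactSpace 𝒜] [SecondCountableTopology 𝒜]
  [MeasurableSpace 𝒜] [BorelSpace 𝒜]
  {Q : Kernel (𝒳 × 𝒜) 𝒳}

/-! ### The verification identity -/

lemma continuous_slack (hQ : WeakFeller Q) (α : ℝ) {ℓ : 𝒳 × 𝒜 → ℝ} (hℓ : Continuous ℓ)
    (V : C(𝒳, ℝ)) : Continuous (slack Q α ℓ V) := by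
  have := hQ V
  unfold slack
  fun_prop

variable [IsMarkovKernel Q] (ν₀ : Measure 𝒳) [IsProbabilityMeasure ν₀] {α : ℝ}

/-- One step of the telescoping: `∫ Q^* V` at time `t` is the integral of `V` at time `t + 1`. -/
lemma integral_slack_marginal (hQ : WeakFeller Q) (α : ℝ) (ℓ : C(𝒳 × 𝒜, ℝ)) (V : C(𝒳, ℝ))
    (π : ℕ → Kernel 𝒳 𝒜) [∀ t, IsMarkovKernel (π t)] (t : ℕ) :
    ∫ z, slack Q α ℓ V z ∂(marginal Q ν₀ π t)
      = ∫ z, ℓ z ∂(marginal Q ν₀ π t) + (α * ∫ x, V x ∂(marginal Q ν₀ π (t + 1)).fst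
        - ∫ x, V x ∂(marginal Q ν₀ π t).fst) := by
  have h1 : ∫ x, V x ∂(marginal Q ν₀ π (t + 1)).fst
      = ∫ z, ∫ y, V y ∂(Q z) ∂(marginal Q ν₀ π t) := by
    have hc : Continuous fun p : (𝒳 × 𝒜) × 𝒳 => V p.2 := by fun_prop
    rw [fst_marginal_succ, ← Measure.snd_compProd, Measure.snd,
      integral_map measurable_snd.aemeasurable V.continuous.measurable.aestronglyMeasurable,
      Measure.integral_compProd (f := fun p => V p.2) (integrable_continuousMap _ ⟨_, hc⟩)]
  have h2 : ∫ x, V x ∂(marginal Q ν₀ π t).fst = ∫ z, V z.1 ∂(marginal Q ν₀ π t) :=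
    integral_map measurable_fst.aemeasurable V.continuous.measurable.aestronglyMeasurable
  have i1 : Integrable (fun z => ℓ z) (marginal Q ν₀ π t) := integrable_continuousMap _ ℓ
  have i2 : Integrable (fun z => ∫ y, V y ∂(Q z)) (marginal Q ν₀ π t) :=
    integrable_continuousMap _ ⟨_, hQ V⟩
  have i3 : Integrable (fun z : 𝒳 × 𝒜 => V z.1) (marginal Q ν₀ π t) :=
    integrable_continuousMap _ (V.comp ⟨Prod.fst, continuous_fst⟩)
  unfold slack
  rw [integral_sub (by exact i1.add (i2.const_mul α)) i3, integral_add i1 (i2.const_mul α),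
    integral_const_mul, h1, h2]
  ring

/-- The verification identity: the discounted cost exceeds `∫ V dν₀` by the discounted sum of the
expected slacks, whatever the continuous function `V` is, since the terms in `V` telescope. -/
lemma hasSum_slack (hQ : WeakFeller Q) (hα₀ : 0 ≤ α) (hα₁ : α < 1)
    (ℓ : C(𝒳 × 𝒜, ℝ)) (V : C(𝒳, ℝ)) (π : ℕ → Kernel 𝒳 𝒜) [∀ t, IsMarkovKernel (π t)] :
    HasSum (fun t => α ^ t * ∫ z, slack Q α ℓ V z ∂(marginal Q ν₀ π t))
      (discountedCost Q ν₀ α ℓ π - ∫ x, V x ∂ν₀) := by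
  set w : ℕ → ℝ := fun t => α ^ t * ∫ x, V x ∂(marginal Q ν₀ π t).fst with hw
  have hsw : Summable w := by
    refine Summable.of_norm_bounded ((summable_geometric_of_lt_one hα₀ hα₁).mul_right ‖V‖)
      fun t => ?_
    rw [hw, norm_mul, Real.norm_of_nonneg (pow_nonneg hα₀ t)]
    exact mul_le_mul_of_nonneg_left (abs_integral_continuousMap_le _ V) (pow_nonneg hα₀ t)
  have hw0 : w 0 = ∫ x, V x ∂ν₀ := by simp [hw, fst_marginal_zero]
  have h1 : HasSum (fun t => w (t + 1) - w t) (- ∫ x, V x ∂ν₀) := by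
    have ha := (hasSum_nat_add_iff' 1).2 hsw.hasSum
    convert! ha.sub hsw.hasSum using 1
    simp [hw0]
  convert! (hasSum_discountedCost Q ν₀ π hα₀ hα₁ ℓ.continuous.measurable
    (fun z => ℓ.norm_coe_le_norm z)).add h1 using 1
  ext t
  rw [integral_slack_marginal ν₀ hQ, hw]
  ring

/-! ### The value function -/

variable [Nonempty 𝒜]

lemma bddBelow_bellman (hQ : WeakFeller Q) (α : ℝ) (ℓ : C(𝒳 × 𝒜, ℝ)) (V : C(𝒳, ℝ)) (x : 𝒳) :
    BddBelow (Set.range fun a : 𝒜 => ℓ (x, a) + α * ∫ y, V y ∂(Q (x, a))) := by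
  refine (isCompact_range ?_).bddBelow
  exact ((ℓ.continuous.add (continuous_const.mul (hQ V))).comp (Continuous.prodMk_right x))

lemma continuous_bellman (hQ : WeakFeller Q) (α : ℝ) (ℓ : C(𝒳 × 𝒜, ℝ)) (V : C(𝒳, ℝ)) :
    Continuous (bellman Q α ℓ V) := by
  have := isCompact_univ.continuous_sInf
    (f := fun (x : 𝒳) (a : 𝒜) => ℓ (x, a) + α * ∫ y, V y ∂(Q (x, a)))
    (ℓ.continuous.add (continuous_const.mul (hQ V)))
  simp only [Set.image_univ] at this
  exact this

lemma bellman_le_add (hQ : WeakFeller Q) (hα₀ : 0 ≤ α) (ℓ : C(𝒳 × 𝒜, ℝ)) (V W : C(𝒳, ℝ)) (x : 𝒳) :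
    bellman Q α ℓ V x ≤ bellman Q α ℓ W x + α * dist V W := by
  rw [← sub_le_iff_le_add]
  refine le_ciInf fun a => ?_
  rw [sub_le_iff_le_add]
  refine (ciInf_le (bddBelow_bellman hQ α ℓ V x) a).trans ?_
  have h : ∫ y, V y ∂(Q (x, a)) ≤ ∫ y, W y ∂(Q (x, a)) + dist V W := by
    have h1 := (abs_le.1 (abs_integral_continuousMap_le (Q (x, a)) (V - W))).2
    simp only [ContinuousMap.sub_apply] at h1
    rw [integral_sub (integrable_continuousMap _ V) (integrable_continuousMap _ W),
      ← dist_eq_norm] at h1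
    linarith
  nlinarith [mul_le_mul_of_nonneg_left h hα₀]

/-- The value iteration converges to a continuous function that satisfies the Bellman equation,
as the Bellman operator is a contraction of `C(𝒳)`. -/
lemma exists_valueFn (hQ : WeakFeller Q) (hα₀ : 0 ≤ α) (hα₁ : α < 1) (ℓ : C(𝒳 × 𝒜, ℝ)) :
    ∃ V : C(𝒳, ℝ), ⇑V = valueFn Q α ℓ ∧ bellman Q α ℓ V = V := by
  let T : C(𝒳, ℝ) → C(𝒳, ℝ) := fun V => ⟨bellman Q α ℓ V, continuous_bellman hQ α ℓ V⟩
  have hT : ContractingWith ⟨α, hα₀⟩ T := by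
    refine ⟨by exact_mod_cast hα₁, LipschitzWith.of_dist_le_mul fun V W => ?_⟩
    refine (ContinuousMap.dist_le (by positivity)).2 fun x => ?_
    rw [Real.dist_eq, abs_sub_le_iff]
    have h1 := bellman_le_add hQ hα₀ ℓ V W x
    have h2 := bellman_le_add hQ hα₀ ℓ W V x
    rw [dist_comm] at h2
    change bellman Q α ℓ V x - bellman Q α ℓ W x ≤ α * dist V W ∧
      bellman Q α ℓ W x - bellman Q α ℓ V x ≤ α * dist V W
    constructor <;> linarith
  refine ⟨hT.fixedPoint, ?_, congrArg DFunLike.coe hT.fixedPoint_isFixedPt⟩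
  have hiter : ∀ t : ℕ, ⇑(T^[t] 0) = (bellman Q α ℓ)^[t] fun _ => 0 := fun t => by
    induction t with
    | zero => rfl
    | succ t ih => rw [Function.iterate_succ_apply', Function.iterate_succ_apply', ← ih]; rfl
  ext x
  refine (Tendsto.limUnder_eq ?_).symm
  simp only [← hiter]
  exact ((continuous_eval_const x).tendsto _).comp (hT.tendsto_iterate_fixedPoint 0)

lemma slack_nonneg (hQ : WeakFeller Q) {ℓ : C(𝒳 × 𝒜, ℝ)} {V : C(𝒳, ℝ)}
    (hV : bellman Q α ℓ V = V) (z : 𝒳 × 𝒜) : 0 ≤ slack Q α ℓ V z := by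
  have h := congrFun hV z.1
  have := ciInf_le (bddBelow_bellman hQ α ℓ V z.1) z.2
  unfold bellman at h
  unfold slack
  linarith

/-- Measurable selection of an `ε`-minimizer: the first suitable member of a dense sequence. -/
lemma exists_measurable_slack_lt (hQ : WeakFeller Q) {ℓ : C(𝒳 × 𝒜, ℝ)} {V : C(𝒳, ℝ)}
    (hV : bellman Q α ℓ V = V) {ε : ℝ} (hε : 0 < ε) :
    ∃ f : 𝒳 → 𝒜, Measurable f ∧ ∀ x, slack Q α ℓ V (x, f x) < ε := by
  classical
  have hc := continuous_slack hQ α ℓ.continuous V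
  have hex : ∀ x, ∃ k, slack Q α ℓ V (x, TopologicalSpace.denseSeq 𝒜 k) < ε := fun x => by
    obtain ⟨a, ha⟩ : ∃ a : 𝒜, slack Q α ℓ V (x, a) < ε := by
      have h := congrFun hV x
      obtain ⟨a, ha⟩ := exists_lt_of_ciInf_lt
        (show (⨅ a : 𝒜, (ℓ (x, a) + α * ∫ y, V y ∂(Q (x, a)))) < V x + ε by
          unfold bellman at h; linarith)
      exact ⟨a, by unfold slack; linarith⟩
    exact (TopologicalSpace.denseRange_denseSeq 𝒜).exists_mem_open
      (s := {a | slack Q α ℓ V (x, a) < ε}) (isOpen_lt (by fun_prop) continuous_const) ⟨a, ha⟩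
  refine ⟨fun x => TopologicalSpace.denseSeq 𝒜 (Nat.find (hex x)), ?_, fun x => Nat.find_spec (hex x)⟩
  exact Measurable.find (p := fun k x => slack Q α ℓ V (x, TopologicalSpace.denseSeq 𝒜 k) < ε)
    (fun k => measurable_const)
    (fun k => (isOpen_lt (by fun_prop) continuous_const).measurableSet) hex

/-- For every `ε > 0` some policy has a cost of at most `∫ V dν₀ + ε / (1 - α)`, where `V` solves
the Bellman equation. -/
lemma exists_discountedCost_le (hQ : WeakFeller Q) (hα₀ : 0 ≤ α) (hα₁ : α < 1)
    {ℓ : C(𝒳 × 𝒜, ℝ)} {V : C(𝒳, ℝ)} (hV : bellman Q α ℓ V = V) {ε : ℝ} (hε : 0 < ε) :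
    ∃ (π : ℕ → Kernel 𝒳 𝒜) (_ : ∀ t, IsMarkovKernel (π t)),
      discountedCost Q ν₀ α ℓ π ≤ ∫ x, V x ∂ν₀ + (1 - α)⁻¹ * ε := by
  obtain ⟨f, hf, hlt⟩ := exists_measurable_slack_lt hQ hV hε
  refine ⟨fun _ => Kernel.deterministic f hf, fun _ => inferInstance, ?_⟩
  rw [← sub_le_iff_le_add']
  refine hasSum_le (fun t => ?_) (hasSum_slack ν₀ hQ hα₀ hα₁ ℓ V _)
    ((hasSum_geometric_of_lt_one hα₀ hα₁).mul_right ε)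
  refine mul_le_mul_of_nonneg_left ?_ (pow_nonneg hα₀ t)
  have hc := continuous_slack hQ α ℓ.continuous V
  have hae : ∀ᵐ z ∂(marginal Q ν₀ (fun _ => Kernel.deterministic f hf) t),
      slack Q α ℓ V z ≤ ε := by
    rw [← fst_marginal_compProd, Measure.ae_compProd_iff
      (isClosed_le hc continuous_const).measurableSet]
    refine ae_of_all _ fun x => ?_
    rw [Kernel.deterministic_apply]
    have hm : MeasurableSet {a | slack Q α ℓ V (x, a) ≤ ε} :=
      (isClosed_le (by fun_prop) continuous_const).measurableSet
    exact (ae_dirac_iff hm).2 (hlt x).le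
  simpa using integral_mono_ae (integrable_continuousMap _ ⟨_, hc⟩) (integrable_const ε) hae

/-- Complementary slackness: a stationary policy is optimal if the slack of some continuous `V` is
nonnegative and vanishes along the policy. -/
lemma isOptimal_of_slack_ae_eq_zero (hQ : WeakFeller Q) (hα₀ : 0 ≤ α) (hα₁ : α < 1)
    {ℓ : C(𝒳 × 𝒜, ℝ)} {V : C(𝒳, ℝ)} (h₀ : ∀ z, 0 ≤ slack Q α ℓ V z)
    (πbar : Kernel 𝒳 𝒜) [IsMarkovKernel πbar]
    (h : ∀ t, ∀ᵐ z ∂(occ Q ν₀ πbar t), slack Q α ℓ V z = 0) :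
    IsOptimal Q ν₀ α ℓ πbar := by
  intro π _
  have h1 : discountedCost Q ν₀ α ℓ (fun _ => πbar) - ∫ x, V x ∂ν₀ = 0 := by
    refine (hasSum_slack ν₀ hQ hα₀ hα₁ ℓ V _).unique ?_
    convert! hasSum_zero using 2 with t
    have ht : ∫ z, slack Q α ℓ V z ∂(marginal Q ν₀ (fun _ => πbar) t) = 0 :=
      integral_eq_zero_of_ae (h t)
    rw [ht, mul_zero]
  have h2 := (hasSum_slack ν₀ hQ hα₀ hα₁ ℓ V π).nonneg
    fun t => mul_nonneg (pow_nonneg hα₀ t) (integral_nonneg h₀)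
  linarith

/-- Complementary slackness: along an optimal stationary policy the slack of the value function
vanishes. -/
lemma slack_ae_eq_zero_of_isOptimal (hQ : WeakFeller Q) (hα₀ : 0 < α) (hα₁ : α < 1)
    {ℓ : C(𝒳 × 𝒜, ℝ)} {V : C(𝒳, ℝ)} (hV : bellman Q α ℓ V = V)
    (πbar : Kernel 𝒳 𝒜) [IsMarkovKernel πbar] (hopt : IsOptimal Q ν₀ α ℓ πbar) (t : ℕ) :
    ∀ᵐ z ∂(occ Q ν₀ πbar t), slack Q α ℓ V z = 0 := by
  have hsum := hasSum_slack ν₀ hQ hα₀.le hα₁ ℓ V (fun _ => πbar)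
  have hnn : ∀ t, 0 ≤ α ^ t * ∫ z, slack Q α ℓ V z ∂(marginal Q ν₀ (fun _ => πbar) t) :=
    fun t => mul_nonneg (pow_nonneg hα₀.le t) (integral_nonneg (slack_nonneg hQ hV))
  have hle : discountedCost Q ν₀ α ℓ (fun _ => πbar) - ∫ x, V x ∂ν₀ ≤ 0 := by
    refine le_of_forall_pos_le_add fun ε hε => ?_
    have h1α : 0 < 1 - α := sub_pos.2 hα₁
    -- the tolerance `(1 - α) ε` per step adds up to `ε`
    obtain ⟨π, hπ, hle⟩ := exists_discountedCost_le ν₀ hQ hα₀.le hα₁ hV (mul_pos h1α hε)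
    rw [inv_mul_cancel_left₀ h1α.ne'] at hle
    linarith [hopt π]
  have hzero : discountedCost Q ν₀ α ℓ (fun _ => πbar) - ∫ x, V x ∂ν₀ = 0 :=
    le_antisymm hle (hsum.nonneg hnn)
  rw [hzero, hasSum_zero_iff_of_nonneg hnn] at hsum
  have ht : ∫ z, slack Q α ℓ V z ∂(marginal Q ν₀ (fun _ => πbar) t) = 0 :=
    (mul_eq_zero.1 (congrFun hsum t)).resolve_left (pow_ne_zero t hα₀.ne')
  exact (integral_eq_zero_iff_of_nonneg (slack_nonneg hQ hV)
    (integrable_continuousMap (marginal Q ν₀ (fun _ => πbar) t)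
      ⟨_, continuous_slack hQ α ℓ.continuous V⟩)).1 ht

end Compact

/-! ### Occupation measures and persistent excitation -/

section Occupation

variable {𝒳 𝒜 : Type*} [MeasurableSpace 𝒳] [MeasurableSpace 𝒜]
  (Q : Kernel (𝒳 × 𝒜) 𝒳) [IsMarkovKernel Q] (ν₀ : Measure 𝒳) [IsProbabilityMeasure ν₀] (α : ℝ)
  (πbar : Kernel 𝒳 𝒜) [IsMarkovKernel πbar]

instance (t : ℕ) : IsProbabilityMeasure (occ Q ν₀ πbar t) :=
  inferInstanceAs (IsProbabilityMeasure (marginal Q ν₀ (fun _ => πbar) t))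

instance {Z : Type*} [MeasurableSpace Z] (μ : Measure Z) [IsFiniteMeasure μ] (c : ℝ) :
    IsFiniteMeasure (ENNReal.ofReal c • μ) :=
  Measure.smul_finite _ ENNReal.ofReal_ne_top

instance (N : ℕ) : IsFiniteMeasure (occN Q ν₀ α πbar N) := by
  unfold occN; infer_instance

instance : SFinite (occSum Q ν₀ α πbar) := by
  unfold occSum; infer_instance

lemma fst_const_smul (μ : Measure (𝒳 × 𝒜)) (c : ENNReal) : (c • μ).fst = c • μ.fst :=
  Measure.map_smul c μ Prod.fst

lemma fst_occ_compProd (t : ℕ) : (occ Q ν₀ πbar t).fst ⊗ₘ πbar = occ Q ν₀ πbar t :=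
  fst_marginal_compProd Q ν₀ (fun _ => πbar) t

lemma fst_occSum_compProd : (occSum Q ν₀ α πbar).fst ⊗ₘ πbar = occSum Q ν₀ α πbar := by
  unfold occSum
  rw [Measure.fst_sum, Measure.compProd_sum_left]
  congr 1
  ext1 t
  rw [fst_const_smul, Measure.compProd_smul_left, fst_occ_compProd]

lemma fst_occN_compProd (N : ℕ) : (occN Q ν₀ α πbar N).fst ⊗ₘ πbar = occN Q ν₀ α πbar N := by
  unfold occN
  rw [fst_const_smul, Measure.compProd_smul_left]
  congr 1
  induction N with
  | zero => simp
  | succ N ih =>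
    rw [Finset.sum_range_succ, Measure.fst_add, Measure.compProd_add_left, ih,
      fst_const_smul, Measure.compProd_smul_left, fst_occ_compProd]

variable {Q ν₀ α πbar}

lemma ae_occN_of_ae_occ {p : 𝒳 × 𝒜 → Prop} (h : ∀ t, ∀ᵐ z ∂(occ Q ν₀ πbar t), p z) (N : ℕ) :
    ∀ᵐ z ∂(occN Q ν₀ α πbar N), p z :=
  Measure.ae_smul_measure
    (ae_finsetSum_measure_iff.2 fun t _ => Measure.ae_smul_measure (h t) _) _

/-- Persistent excitation carries properties seen during the first `N` steps over to all times:
the occupation measures disintegrate along the same policy, so that absolute continuity of the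
state marginals is absolute continuity of the measures. -/
lemma ae_occ_of_ae_occN (hα₀ : 0 < α) {N : ℕ} (hN : PersistentExcitation Q ν₀ α πbar N)
    {p : 𝒳 × 𝒜 → Prop} (h : ∀ᵐ z ∂(occN Q ν₀ α πbar N), p z) (t : ℕ) :
    ∀ᵐ z ∂(occ Q ν₀ πbar t), p z := by
  have hac : occSum Q ν₀ α πbar ≪ occN Q ν₀ α πbar N := by
    rw [← fst_occSum_compProd, ← fst_occN_compProd]
    exact hN.2.compProd_left πbar
  have hsum := hac.ae_le h
  exact (Measure.ae_ennreal_smul_measure_iff (by simp [pow_pos hα₀ t])).1 (Measure.ae_sum_iff.1 hsum t)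

end Occupation

section LP

/-! ### Solutions of the program -/

lemma slack_const_smul {𝒳 𝒜 : Type*} [MeasurableSpace 𝒳] [MeasurableSpace 𝒜] {n : ℕ}
    (Q : Kernel (𝒳 × 𝒜) 𝒳) (α : ℝ) (φ : 𝒳 × 𝒜 → Fin n → ℝ) (θ : Fin n → ℝ) (V : 𝒳 → ℝ) (c : ℝ)
    (z : 𝒳 × 𝒜) :
    slack Q α (cost φ (c • θ)) (fun x => c * V x) z = c * slack Q α (cost φ θ) V z := by
  simp only [slack, cost, Pi.smul_apply, smul_eq_mul, mul_assoc, ← Finset.mul_sum,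
    integral_const_mul]
  ring

/-- A positive factor in the cost does not affect optimality. -/
lemma isOptimal_of_smul {𝒳 𝒜 : Type*} [MeasurableSpace 𝒳] [MeasurableSpace 𝒜] {n : ℕ}
    {Q : Kernel (𝒳 × 𝒜) 𝒳} [IsMarkovKernel Q] {ν₀ : Measure 𝒳} {α : ℝ}
    {φ : 𝒳 × 𝒜 → Fin n → ℝ} {θ : Fin n → ℝ} {c : ℝ} (hc : 0 < c)
    {πbar : Kernel 𝒳 𝒜} [IsMarkovKernel πbar] (h : IsOptimal Q ν₀ α (cost φ (c • θ)) πbar) :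
    IsOptimal Q ν₀ α (cost φ θ) πbar := by
  have key : ∀ (π : ℕ → Kernel 𝒳 𝒜) [∀ t, IsMarkovKernel (π t)],
      discountedCost Q ν₀ α (cost φ (c • θ)) π = c * discountedCost Q ν₀ α (cost φ θ) π := by
    intro π _
    unfold discountedCost
    rw [← integral_const_mul]
    congr 1
    ext ω
    rw [← tsum_mul_left]
    congr 1
    ext t
    simp only [cost, Pi.smul_apply, smul_eq_mul, mul_assoc, ← Finset.mul_sum]
    ring
  intro π _
  have := h π
  rw [key, key] at this
  exact le_of_mul_le_mul_left this hc

variable {𝒳 𝒜 : Type*} [TopologicalSpace 𝒳] [CompactSpace 𝒳] [SecondCountableTopology 𝒳]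
  [MeasurableSpace 𝒳] [BorelSpace 𝒳]
  [TopologicalSpace 𝒜] [CompactSpace 𝒜] [SecondCountableTopology 𝒜]
  [MeasurableSpace 𝒜] [BorelSpace 𝒜]
  {n : ℕ} {Q : Kernel (𝒳 × 𝒜) 𝒳} {α : ℝ} {φ : 𝒳 × 𝒜 → Fin n → ℝ}

lemma continuous_cost (hφ : Continuous φ) (θ : Fin n → ℝ) : Continuous (cost φ θ) := by
  unfold cost
  fun_prop

variable [IsMarkovKernel Q] {ν₀ : Measure 𝒳} [IsProbabilityMeasure ν₀]
  {lam : Measure (𝒳 × 𝒜)} {βV βℓ : ℝ} {πbar : Kernel 𝒳 𝒜} [IsMarkovKernel πbar] {N : ℕ}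

/-- A parameter to which the expert is optimal gives, together with its value function and after
scaling by any admissible `c > 0`, a feasible point with objective value zero. -/
lemma exists_feasible_of_isOptimal [Nonempty 𝒜] (hQ : WeakFeller Q) (hα₀ : 0 < α) (hα₁ : α < 1)
    (hφ : Continuous φ) {θ : Fin n → ℝ} (hopt : IsOptimal Q ν₀ α (cost φ θ) πbar) {c : ℝ}
    (hc : 0 < c) (hgap : 1 ≤ c * gap lam Q α φ θ)
    (hV : ∀ x, c * |valueFn Q α (cost φ θ) x| ≤ βV) (hθ : c * ∑ i, |θ i| ≤ βℓ) :
    ∃ (V : C(𝒳, ℝ)) (ψ : C(𝒳 × 𝒜, ℝ)), Feasible lam Q α φ βV βℓ ψ (c • θ) V ∧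
      ∫ z, ψ z ∂(occN Q ν₀ α πbar N) = 0 := by
  obtain ⟨V, hVeq, hfix⟩ := exists_valueFn hQ hα₀.le hα₁ ⟨_, continuous_cost hφ θ⟩
  simp only [ContinuousMap.coe_mk] at hVeq hfix
  have hslack : ∀ z, slack Q α (cost φ (c • θ)) ⇑(c • V) z = c * slack Q α (cost φ θ) V z :=
    slack_const_smul Q α φ θ V c
  refine ⟨c • V, ⟨_, continuous_slack hQ α (continuous_cost hφ (c • θ)) (c • V)⟩,
    ⟨fun z => rfl, ?_, fun z => ?_, fun x => ?_, ?_⟩, ?_⟩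
  · simp only [ContinuousMap.coe_mk, hslack]
    rw [integral_const_mul, hVeq]
    exact hgap
  · simp only [ContinuousMap.coe_mk, hslack]
    exact mul_nonneg hc.le (slack_nonneg (ℓ := ⟨_, continuous_cost hφ θ⟩) hQ hfix z)
  · rw [← hVeq] at hV
    simpa [abs_mul, abs_of_pos hc] using hV x
  · simpa [abs_mul, abs_of_pos hc, ← Finset.mul_sum] using hθ
  · refine integral_eq_zero_of_ae (ae_occN_of_ae_occ (fun t => ?_) N)
    filter_upwards [slack_ae_eq_zero_of_isOptimal (ℓ := ⟨_, continuous_cost hφ θ⟩) ν₀ hQ hα₀ hα₁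
      hfix πbar hopt t] with z hz
    simp only [ContinuousMap.coe_mk] at hz ⊢
    rw [hslack, hz, mul_zero, Pi.zero_apply]

/-- A feasible point with objective value zero makes the expert optimal. -/
lemma Feasible.isOptimal [Nonempty 𝒜] (hQ : WeakFeller Q) (hα₀ : 0 < α) (hα₁ : α < 1)
    (hφ : Continuous φ) (hN : PersistentExcitation Q ν₀ α πbar N)
    {ψ : C(𝒳 × 𝒜, ℝ)} {θ : Fin n → ℝ} {V : C(𝒳, ℝ)} (h : Feasible lam Q α φ βV βℓ ψ θ V)
    (h₀ : ∫ z, ψ z ∂(occN Q ν₀ α πbar N) = 0) : IsOptimal Q ν₀ α (cost φ θ) πbar := by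
  have hae := (integral_eq_zero_iff_of_nonneg h.psi_nonneg (integrable_continuousMap _ ψ)).1 h₀
  have hψ := h.psi_nonneg
  simp only [h.psi_eq] at hψ
  refine isOptimal_of_slack_ae_eq_zero (ℓ := ⟨_, continuous_cost hφ θ⟩) (V := V) ν₀ hQ hα₀.le hα₁
    hψ πbar fun t => ?_
  filter_upwards [ae_occ_of_ae_occN hα₀ hN hae t] with z hz
  exact (h.psi_eq z).symm.trans hz

/-- Zero is a lower bound of the objective, so that it is enough to attain it. -/
lemma Feasible.solves {μ : Measure (𝒳 × 𝒜)} {ψ : C(𝒳 × 𝒜, ℝ)} {θ : Fin n → ℝ} {V : C(𝒳, ℝ)}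
    (h : Feasible lam Q α φ βV βℓ ψ θ V) (h₀ : ∫ z, ψ z ∂μ = 0) :
    Solves lam μ Q α φ βV βℓ ψ θ V :=
  ⟨h, fun _ _ _ h' => h₀.trans_le (integral_nonneg h'.psi_nonneg)⟩

end LP

end IOC

end

theorem mainTheorem2 {nx na nl : ℕ}
    (X : Set (EuclideanSpace ℝ (Fin nx))) (hX : IsCompact X)
    (A : Set (EuclideanSpace ℝ (Fin na))) (hA : IsCompact A) (hA' : A.Nonempty)
    (Q : Kernel (X × A) X) [IsMarkovKernel Q] (hQ : IOC.WeakFeller Q)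
    (ν₀ : Measure X) [IsProbabilityMeasure ν₀]
    (α : ℝ) (hα₀ : 0 < α) (hα₁ : α < 1)
    (φ : X × A → Fin nl → ℝ) (hφ : Continuous φ)
    -- the true cost parameter, to which the stationary expert policy is optimal
    (θbar : Fin nl → ℝ)
    (πbar : Kernel X A) [IsMarkovKernel πbar]
    (hopt : IOC.IsOptimal Q ν₀ α (IOC.cost φ θbar) πbar)
    -- regularity condition on the true cost
    (hreg : 0 < IOC.gap (IOC.lebesgueOn X A) Q α φ θbar)
    -- persistent excitation
    (N : ℕ) (hN : IOC.PersistentExcitation Q ν₀ α πbar N)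
    -- the norm bounds of the program are sufficiently large
    (βV βl : ℝ) (hβ : IOC.BoundsLargeEnough (IOC.lebesgueOn X A) Q α φ βV βl θbar) :
    -- the minimum is attained and equals zero
    IsLeast (IOC.objectiveValues (IOC.lebesgueOn X A) (IOC.occN Q ν₀ α πbar N)
      Q α φ βV βl) 0 ∧
    -- the cost parameter of every solution makes the expert policy optimal
    (∀ θ : Fin nl → ℝ,
      (∃ (V : C(X, ℝ)) (ψ : C(X × A, ℝ)),
        IOC.Solves (IOC.lebesgueOn X A) (IOC.occN Q ν₀ α πbar N) Q α φ βV βl ψ θ V) →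
      IOC.IsOptimal Q ν₀ α (IOC.cost φ θ) πbar) ∧
    -- the equivalence for parameters that respect the normalization of the program
    (∀ θ : Fin nl → ℝ,
      1 ≤ IOC.gap (IOC.lebesgueOn X A) Q α φ θ →
      (∀ x, |IOC.valueFn Q α (IOC.cost φ θ) x| ≤ βV) →
      ∑ i, |θ i| ≤ βl →
      (IOC.IsOptimal Q ν₀ α (IOC.cost φ θ) πbar ↔
        ∃ (V : C(X, ℝ)) (ψ : C(X × A, ℝ)),
          IOC.Solves (IOC.lebesgueOn X A) (IOC.occN Q ν₀ α πbar N) Q α φ βV βl ψ θ V)) ∧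
    -- the equivalence, up to a positive factor, for all parameters that satisfy the
    -- regularity condition and for which the norm bounds are sufficiently large
    (∀ θ : Fin nl → ℝ,
      0 < IOC.gap (IOC.lebesgueOn X A) Q α φ θ →
      IOC.BoundsLargeEnough (IOC.lebesgueOn X A) Q α φ βV βl θ →
      (IOC.IsOptimal Q ν₀ α (IOC.cost φ θ) πbar ↔
        ∃ c : ℝ, 0 < c ∧ ∃ (V : C(X, ℝ)) (ψ : C(X × A, ℝ)),
          IOC.Solves (IOC.lebesgueOn X A) (IOC.occN Q ν₀ α πbar N) Q α φ βV βl
            ψ (c • θ) V)) := by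
  have : CompactSpace X := isCompact_iff_compactSpace.1 hX
  have : CompactSpace A := isCompact_iff_compactSpace.1 hA
  have : Nonempty A := hA'.to_subtype
  -- an optimal expert gives a feasible point with objective zero along the ray of `θ`
  have hbounds : ∀ θ : Fin nl → ℝ, 0 < IOC.gap (IOC.lebesgueOn X A) Q α φ θ →
      IOC.BoundsLargeEnough (IOC.lebesgueOn X A) Q α φ βV βl θ →
      IOC.IsOptimal Q ν₀ α (IOC.cost φ θ) πbar →
      ∃ c : ℝ, 0 < c ∧ ∃ (V : C(X, ℝ)) (ψ : C(X × A, ℝ)),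
        IOC.Feasible (IOC.lebesgueOn X A) Q α φ βV βl ψ (c • θ) V ∧
          ∫ z, ψ z ∂(IOC.occN Q ν₀ α πbar N) = 0 := by
    intro θ hgap hb hθ
    -- the factor that normalizes the gap to one
    refine ⟨(IOC.gap (IOC.lebesgueOn X A) Q α φ θ)⁻¹, inv_pos.2 hgap,
      IOC.exists_feasible_of_isOptimal hQ hα₀ hα₁ hφ hθ (inv_pos.2 hgap)
        (inv_mul_cancel₀ hgap.ne').ge (fun x => ?_) ?_⟩
    · rw [inv_mul_eq_div]
      exact hb.value_le x
    · rw [inv_mul_eq_div]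
      exact hb.param_le
  obtain ⟨c₀, -, V₀, ψ₀, hfeas₀, hzero₀⟩ := hbounds θbar hreg hβ hopt
  have hsol : ∀ θ : Fin nl → ℝ, (∃ (V : C(X, ℝ)) (ψ : C(X × A, ℝ)),
      IOC.Solves (IOC.lebesgueOn X A) (IOC.occN Q ν₀ α πbar N) Q α φ βV βl ψ θ V) →
      IOC.IsOptimal Q ν₀ α (IOC.cost φ θ) πbar := by
    rintro θ ⟨V, ψ, hf, hmin⟩
    exact hf.isOptimal hQ hα₀ hα₁ hφ hN
      (le_antisymm ((hmin _ _ _ hfeas₀).trans_eq hzero₀) (integral_nonneg hf.psi_nonneg))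
  refine ⟨⟨⟨ψ₀, c₀ • θbar, V₀, hfeas₀, hzero₀.symm⟩, ?_⟩, hsol, ?_, ?_⟩
  · rintro r ⟨ψ, θ, V, hf, rfl⟩
    exact integral_nonneg hf.psi_nonneg
  · intro θ hgap hV hθ
    -- no scaling is needed here, as the bounds hold for the value function itself
    refine ⟨fun h => ?_, hsol θ⟩
    obtain ⟨V, ψ, hf, h₀⟩ := IOC.exists_feasible_of_isOptimal (c := 1) (N := N) (βV := βV)
      (βℓ := βl) hQ hα₀ hα₁ hφ h
      one_pos (by rwa [one_mul]) (by simpa only [one_mul] using hV) (by rwa [one_mul])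
    rw [one_smul] at hf
    exact ⟨V, ψ, hf.solves h₀⟩
  · intro θ hgap hb
    constructor
    · intro h
      obtain ⟨c, hc, V, ψ, hf, h₀⟩ := hbounds θ hgap hb h
      exact ⟨c, hc, V, ψ, hf.solves h₀⟩
    · rintro ⟨c, hc, h⟩
      exact IOC.isOptimal_of_smul hc (hsol _ h)
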